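/- \textbf{Model.} Let $\Sigma$ be an alphabet with at least two symbols. For a string $T\in\Sigma^n$ and positions $i,j$ in $T$, let $\mathrm{LCE}(i,j)$ be the length of the longest common prefix of the suffixes of $T$ starting at positions $i$ and $j$. An LCE data structure for strings of length $n$ over $\Sigma$ in the non-uniform cell probe model stores, for each $T\in\Sigma^n$, some additional memory depending on $T$, divided into cells of fixed (arbitrary) numbers of bits. Every query $(i,j)$ is answered by a deterministic algorithm that adaptively probes cells, each of which is either one of the $n$ read-only cells of $T$ (one character per cell) or one of the additional cells, and that returns $\mathrm{LCE}(i,j)$ correctly for every $T$. Computation is free, and the algorithms for different $n$ may be unrelated. The \emph{additional space} is the total number of bits of the additional cells (the string $T$ itself is not counted), and the \emph{query time} is the maximum number of cells probed, over all $T\in\Sigma^n$ and all queries. \textbf{Lemma.} In the non-uniform cell probe model, any LCE data structure that uses $O(n/\tau)$ bits of additional space for an input string of length $n$ requires $\Omega(\tau)$ query time, for any $\tau$ with $1\le\tau\le n$. Precisely: for every constant $C>0$ there is a constant $c>0$, depending only on $C$, such that for every alphabet $\Sigma$ with at least two symbols, every integer $n\ge 2$ and every real $\tau$ with $1\le\tau\le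 n$, every LCE data structure for strings of length $n$ over $\Sigma$ that uses at most $C\,n/\tau$ bits of additional space has query time at least $c\,\tau$. -/

import Mathlib

namespace CellProbe

/-- A deterministic query algorithm in the cell probe model. The memory consists of
* the read-only input array, `n` cells holding one character of `α` each;
* `m` additional cells, the `k`-th of which holds `width k` bits.

The algorithm probes cells adaptively: the continuation is an arbitrary function of the content
that was read, so that computation is free. Finally it returns a value of `β`. -/
inductive Algorithm (α : Type*) (n m : ℕ) (width : Fin m → ℕ) (β : Type*) where
  | answer (b : β) : Algorithm α n m width β
  | probeInput (p : Fin n) (next : α → Algorithm α n m width β) : Algorithm α n m width β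
  | probeExtra (k : Fin m) (next : (Fin (width k) → Bool) → Algorithm α n m width β) :
      Algorithm α n m width β

namespace Algorithm

/-- The value returned on input array `T` and additional memory `M`. -/
def output {α : Type*} {n m : ℕ} {width : Fin m → ℕ} {β : Type*}
    (T : Fin n → α) (M : (k : Fin m) → Fin (width k) → Bool) : Algorithm α n m width β → β
  | answer b => b
  | probeInput p next => output T M (next (T p))
  | probeExtra k next => output T M (next (M k))

/-- The running time on input array `T` and additional memory `M`: the number of cells probed,
in the input array and in the additional memory together. -/
def probes {α : Type*} {n m : ℕ} {width : Fin m → ℕ} {β : Type*}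
    (T : Fin n → α) (M : (k : Fin m) → Fin (width k) → Bool) : Algorithm α n m width β → ℕ
  | answer _ => 0
  | probeInput p next => probes T M (next (T p)) + 1
  | probeExtra k next => probes T M (next (M k)) + 1

end Algorithm

/-- The suffixes of `T` starting at `i` and at `j` both have length at least `l` and agree on
their first `l` characters. -/
def CommonPrefix {α : Type*} {n : ℕ} (T : Fin n → α) (i j : Fin n) (l : ℕ) : Prop :=
  ∃ (hi : i.val + l ≤ n) (hj : j.val + l ≤ n), ∀ (k : ℕ) (hk : k < l),
    T ⟨i.val + k, by omega⟩ = T ⟨j.val + k, by omega⟩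

/-- The longest common extension `LCE(i, j)`: the length of the longest common prefix of the
suffixes of `T` starting at positions `i` and `j`. -/
noncomputable def lce {α : Type*} {n : ℕ} (T : Fin n → α) (i j : Fin n) : ℕ :=
  sSup {l : ℕ | CommonPrefix T i j l}

/-- The supremum in the definition of `lce` is a maximum. -/
theorem isGreatest_lce {α : Type*} {n : ℕ} (T : Fin n → α) (i j : Fin n) :
    IsGreatest {l : ℕ | CommonPrefix T i j l} (lce T i j) := by
  have hne : {l : ℕ | CommonPrefix T i j l}.Nonempty :=
    ⟨0, by have := i.isLt; omega, by have := j.isLt; omega, fun k hk => by omega⟩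
  have hbdd : BddAbove {l : ℕ | CommonPrefix T i j l} :=
    ⟨n, fun l hl => by obtain ⟨hi, -, -⟩ := hl; omega⟩
  exact ⟨Nat.sSup_mem hne hbdd, fun l hl => le_csSup hbdd hl⟩

/-- A data structure for LCE queries on strings of length `n` over `α`. As `n` is fixed, the
algorithms for different `n` are unrelated (non-uniformity). -/
structure LCEDataStructure (α : Type*) (n : ℕ) where
  /-- The number of cells in addition to the input string. -/
  cells : ℕ
  /-- The number of bits in each of these cells. -/
  width : Fin cells → ℕ
  /-- The content of the additional cells for a given string. -/
  preprocess : (Fin n → α) → (k : Fin cells) → Fin (width k) → Bool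
  /-- The algorithm that answers the query `(i, j)`. -/
  query : Fin n → Fin n → Algorithm α n cells width ℕ
  /-- All queries on all strings are answered correctly. -/
  correct : ∀ (T : Fin n → α) (i j : Fin n),
    (query i j).output T (preprocess T) = lce T i j

namespace LCEDataStructure

/-- The additional space in bits; the input string is not counted. -/
def space {α : Type*} {n : ℕ} (D : LCEDataStructure α n) : ℕ :=
  ∑ k, D.width k

/-- The time for answering the query `(i, j)` on the string `T`. -/
def time {α : Type*} {n : ℕ} (D : LCEDataStructure α n) (T : Fin n → α) (i j : Fin n) : ℕ :=
  (D.query i j).probes T (D.preprocess T)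

/-- The worst-case query time, over all strings of length `n` and all queries; it is an extended
natural number since `α` may be infinite. -/
noncomputable def queryTime {α : Type*} {n : ℕ} (D : LCEDataStructure α n) : ℕ∞ :=
  ⨆ (T : Fin n → α) (i : Fin n) (j : Fin n), (D.time T i j : ℕ∞)

end LCEDataStructure

end CellProbe

/-! Encoding argument. Consider strings whose first half is constantly `a`, followed by `N` blocks
of length `B`, about `τ / 2`, each with a single `b` at a free offset. The LCE of position 0 and a
block start is the offset of that block, so `N` queries, at most `t * N` probes, recover the string.
Once the extra memory is fixed, only input probes branch, and at most `N` distinct positions can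
read `b`; hence few outcomes are possible, at most `(e * t) ^ N` (`Algorithm.card_le`). Summing over
all memories, `B ^ N ≤ 2 ^ S * (e * t) ^ N` for `S` extra bits. As `S = O(N)`, taking `N`-th roots
gives `B = O(t)`. -/

namespace CellProbe

open Finset

/-! ### Counting the outcomes of a query algorithm with fixed memory -/

namespace Algorithm

/-- Run `A`, then run the algorithm that `f` assigns to its answer. -/
def bind {α : Type*} {n m : ℕ} {width : Fin m → ℕ} {β γ : Type*}
    (f : β → Algorithm α n m width γ) : Algorithm α n m width β → Algorithm α n m width γ
  | answer b => f b
  | probeInput p next => probeInput p fun x => bind f (next x)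
  | probeExtra k next => probeExtra k fun x => bind f (next x)

theorem output_bind {α : Type*} {n m : ℕ} {width : Fin m → ℕ} {β γ : Type*}
    (T : Fin n → α) (M : (k : Fin m) → Fin (width k) → Bool)
    (f : β → Algorithm α n m width γ) (A : Algorithm α n m width β) :
    (bind f A).output T M = (f (A.output T M)).output T M := by
  induction A with
  | answer b => rfl
  | probeInput p next ih => exact ih (T p)
  | probeExtra k next ih => exact ih (M k)

theorem probes_bind {α : Type*} {n m : ℕ} {width : Fin m → ℕ} {β γ : Type*}
    (T : Fin n → α) (M : (k : Fin m) → Fin (width k) → Bool)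
    (f : β → Algorithm α n m width γ) (A : Algorithm α n m width β) :
    (bind f A).probes T M = A.probes T M + (f (A.output T M)).probes T M := by
  induction A with
  | answer b => simp [bind, probes, output]
  | probeInput p next ih => simp only [bind, probes, output, ih]; omega
  | probeExtra k next ih => simp only [bind, probes, output, ih]; omega

/-- Run a list of algorithms one after the other and return the list of their answers. -/
def sequence {α : Type*} {n m : ℕ} {width : Fin m → ℕ} {β : Type*} :
    List (Algorithm α n m width β) → Algorithm α n m width (List β)
  | [] => answer []
  | A :: L => bind (fun b => bind (fun l => answer (b :: l)) (sequence L)) A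

theorem output_sequence {α : Type*} {n m : ℕ} {width : Fin m → ℕ} {β : Type*}
    (T : Fin n → α) (M : (k : Fin m) → Fin (width k) → Bool)
    (L : List (Algorithm α n m width β)) :
    (sequence L).output T M = L.map (output T M) := by
  induction L with
  | nil => rfl
  | cons A L ih => simp [sequence, output_bind, output, ih]

theorem probes_sequence {α : Type*} {n m : ℕ} {width : Fin m → ℕ} {β : Type*}
    (T : Fin n → α) (M : (k : Fin m) → Fin (width k) → Bool)
    (L : List (Algorithm α n m width β)) :
    (sequence L).probes T M = (L.map (probes T M)).sum := by
  induction L with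
  | nil => rfl
  | cons A L ih => simp [sequence, probes_bind, probes, ih]

open Classical in
/-- A weighted Kraft inequality: if an algorithm with at most `d` probes distinguishes the strings
of a family over two symbols, all of which have the symbol `b` on `P`, then the sum of
`x ^ (number of occurrences of b outside P)` over the family is at most `(1 + x) ^ d`. -/
theorem sum_pow_le {α : Type*} {n m : ℕ} {width : Fin m → ℕ} {β : Type*} {a b : α}
    (M : (k : Fin m) → Fin (width k) → Bool) {x : ℝ} (hx0 : 0 ≤ x) (hx1 : x ≤ 1)
    (A : Algorithm α n m width β) :
    ∀ (d : ℕ) (P : Finset (Fin n)) (F : Finset (Fin n → α)),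
      (∀ T ∈ F, ∀ p, T p = a ∨ T p = b) → (∀ T ∈ F, ∀ p ∈ P, T p = b) →
      (∀ T ∈ F, A.probes T M ≤ d) → Set.InjOn (fun T => A.output T M) F →
      ∑ T ∈ F, x ^ #{p | T p = b ∧ p ∉ P} ≤ (1 + x) ^ d := by
  induction A with
  | answer c =>
    intro d P F _ _ _ hinj
    have hF : #F ≤ 1 := Finset.card_le_one.2 fun T hT T' hT' => hinj hT hT' rfl
    calc ∑ T ∈ F, x ^ #{p | T p = b ∧ p ∉ P} ≤ ∑ T ∈ F, (1 : ℝ) :=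
          Finset.sum_le_sum fun T _ => pow_le_one₀ hx0 hx1
      _ ≤ 1 := by simpa using hF
      _ ≤ (1 + x) ^ d := one_le_pow₀ (by linarith)
  | probeExtra k next ih =>
    intro d P F hF hP hd hinj
    -- The memory is the same for the whole family, so this probe does not branch.
    exact ih (M k) d P F hF hP (fun T hT => (Nat.le_succ _).trans (hd T hT)) hinj
  | probeInput p next ih =>
    intro d P F hF hP hd hinj
    rcases F.eq_empty_or_nonempty with rfl | ⟨T₀, hT₀⟩
    · simp only [Finset.sum_empty]; positivity
    obtain ⟨e, rfl⟩ : ∃ e, d = e + 1 :=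
      ⟨d - 1, by have := hd T₀ hT₀; simp only [probes] at this; omega⟩
    have branch (c : α) (G : Finset (Fin n → α)) (hG : G ⊆ F) (hc : ∀ T ∈ G, T p = c)
        (Q : Finset (Fin n)) (hQ : ∀ T ∈ G, ∀ q ∈ Q, T q = b) :
        ∑ T ∈ G, x ^ #{q | T q = b ∧ q ∉ Q} ≤ (1 + x) ^ e := by
      refine ih c e Q G (fun T hT => hF T (hG hT)) hQ (fun T hT => ?_) fun T hT T' hT' h => ?_
      · have := hd T (hG hT)
        simp only [probes, hc T hT] at this
        omega
      · refine hinj (hG hT) (hG hT') ?_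
        simpa only [output, hc T hT, hc T' hT'] using h
    -- `P` records positions already read as `b`; probing one again yields nothing new.
    by_cases hp : p ∈ P
    · calc _ ≤ (1 + x) ^ e := branch b F subset_rfl (fun T hT => hP T hT p hp) P hP
        _ ≤ (1 + x) ^ (e + 1) := pow_le_pow_right₀ (by linarith) (Nat.le_succ e)
    -- On the `b` branch `p` joins `P`, which costs one factor `x`; the `a` branch costs none.
    -- Together they give `1 + x`.
    · have h1 : ∑ T ∈ F with T p = b, x ^ #{q | T q = b ∧ q ∉ P} ≤ x * (1 + x) ^ e := by
        have := branch b {T ∈ F | T p = b} (Finset.filter_subset _ _)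
          (fun T hT => (Finset.mem_filter.1 hT).2) (insert p P) (fun T hT q hq => by
            rw [Finset.mem_filter] at hT
            rcases Finset.mem_insert.1 hq with rfl | hq
            exacts [hT.2, hP T hT.1 q hq])
        refine le_trans (le_of_eq ?_) (mul_le_mul_of_nonneg_left this hx0)
        rw [Finset.mul_sum]
        refine Finset.sum_congr rfl fun T hT => ?_
        have hins : (Finset.univ.filter fun q => T q = b ∧ q ∉ P) =
            insert p (Finset.univ.filter fun q => T q = b ∧ q ∉ insert p P) := by
          ext q
          by_cases hq : q = p
          · subst hq; simp [hp, (Finset.mem_filter.1 hT).2]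
          · simp [hq]
        rw [hins, Finset.card_insert_of_notMem (by simp), pow_succ']
      have h0 : ∑ T ∈ F with ¬ T p = b, x ^ #{q | T q = b ∧ q ∉ P} ≤ (1 + x) ^ e :=
        branch a _ (Finset.filter_subset _ _)
          (fun T hT => (hF T (Finset.mem_filter.1 hT).1 p).resolve_right (Finset.mem_filter.1 hT).2)
          P (fun T hT => hP T (Finset.mem_filter.1 hT).1)
      rw [← Finset.sum_filter_add_sum_filter_not F (fun T => T p = b), pow_succ]
      linarith

open Classical in
/-- If an algorithm with at most `t * N` probes distinguishes the strings of a family over two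
symbols, each of which has at most `N` occurrences of `b`, then the family has at most
`(e * t) ^ N` members. -/
theorem card_le {α : Type*} {n m : ℕ} {width : Fin m → ℕ} {β : Type*} {a b : α}
    (M : (k : Fin m) → Fin (width k) → Bool) (A : Algorithm α n m width β) {t N : ℕ}
    (ht : 1 ≤ t) (F : Finset (Fin n → α)) (hF : ∀ T ∈ F, ∀ p, T p = a ∨ T p = b)
    (hN : ∀ T ∈ F, #{p | T p = b} ≤ N) (hd : ∀ T ∈ F, A.probes T M ≤ t * N)
    (hinj : Set.InjOn (fun T => A.output T M) F) :
    (#F : ℝ) ≤ (Real.exp 1 * t) ^ N := by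
  have ht0 : (1 : ℝ) ≤ t := by exact_mod_cast ht
  have hx0 : (0 : ℝ) ≤ (t : ℝ)⁻¹ := by positivity
  have hx1 : (t : ℝ)⁻¹ ≤ 1 := inv_le_one_of_one_le₀ ht0
  -- The weight `x = 1 / t` makes `(1 + x) ^ (t * N)` at most `e ^ N`, while each string weighs at
  -- least `t ^ (-N)`.
  have key := sum_pow_le M hx0 hx1 A (t * N) ∅ F hF (by simp) hd hinj
  have lower : (#F : ℝ) * (t : ℝ)⁻¹ ^ N ≤ Real.exp 1 ^ N := by
    calc (#F : ℝ) * (t : ℝ)⁻¹ ^ N = ∑ T ∈ F, (t : ℝ)⁻¹ ^ N := by simp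
      _ ≤ ∑ T ∈ F, (t : ℝ)⁻¹ ^ #{p | T p = b ∧ p ∉ (∅ : Finset (Fin n))} := by
          refine Finset.sum_le_sum fun T hT => pow_le_pow_of_le_one hx0 hx1 ?_
          simpa using hN T hT
      _ ≤ (1 + (t : ℝ)⁻¹) ^ (t * N) := key
      _ ≤ (Real.exp (t : ℝ)⁻¹) ^ (t * N) := by
          gcongr
          linarith [Real.add_one_le_exp (t : ℝ)⁻¹]
      _ = Real.exp 1 ^ N := by
          rw [pow_mul, ← Real.exp_nat_mul, mul_inv_cancel₀ (by positivity)]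
  rw [inv_pow, ← div_eq_mul_inv, div_le_iff₀ (by positivity)] at lower
  rwa [mul_pow]

end Algorithm

/-! ### The hard strings -/

open Classical in
/-- The string that is constantly `a` except that, for every `s`, the `s`-th block of length `B`
after the first `h` symbols has the symbol `b` at offset `f s`. -/
noncomputable def blockString {α : Type*} (a b : α) (n h : ℕ) {N B : ℕ} (f : Fin N → Fin B) :
    Fin n → α :=
  fun p => if ∃ s : Fin N, p.val = h + s * B + f s then b else a

theorem blockString_eq_or {α : Type*} (a b : α) (n h : ℕ) {N B : ℕ} (f : Fin N → Fin B)
    (p : Fin n) : blockString a b n h f p = a ∨ blockString a b n h f p = b := by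
  unfold blockString
  split_ifs <;> simp

open Classical in
theorem card_blockString_le {α : Type*} {a b : α} (hab : a ≠ b) (n h : ℕ) {N B : ℕ}
    (f : Fin N → Fin B) : #{p | blockString a b n h f p = b} ≤ N := by
  calc #{p | blockString a b n h f p = b}
      = #(Finset.image Fin.val {p | blockString a b n h f p = b}) :=
        (Finset.card_image_of_injective _ Fin.val_injective).symm
    _ ≤ #(Finset.image (fun s : Fin N => h + s * B + f s) Finset.univ) := by
        refine Finset.card_le_card fun q hq => ?_
        simp only [Finset.mem_image, Finset.mem_filter, Finset.mem_univ, true_and] at hq ⊢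
        obtain ⟨p, hp, rfl⟩ := hq
        unfold blockString at hp
        split_ifs at hp with hs
        · obtain ⟨s, hs⟩ := hs
          exact ⟨s, hs.symm⟩
        · exact absurd hp hab
    _ ≤ N := Finset.card_image_le.trans (by simp)

theorem lce_eq_of_isGreatest {α : Type*} {n : ℕ} {T : Fin n → α} {i j : Fin n} {l : ℕ}
    (h : IsGreatest {l : ℕ | CommonPrefix T i j l} l) : lce T i j = l :=
  (isGreatest_lce T i j).unique h

/-- As `B ≤ h`, the suffix at 0 starts with `B` copies of `a`, so the first mismatch is the `b` of
block `s`. -/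
theorem lce_blockString {α : Type*} {a b : α} (hab : a ≠ b) {n h N B : ℕ}
    (hB : B ≤ h) (hn : h + N * B ≤ n) (f : Fin N → Fin B) (s : Fin N) {i j : Fin n}
    (hi : i.val = 0) (hj : j.val = h + s * B) :
    lce (blockString a b n h f) i j = f s := by
  have hs : (s + 1 : ℕ) * B ≤ N * B := Nat.mul_le_mul_right _ s.isLt
  rw [add_mul, one_mul] at hs
  have hfs := (f s).isLt
  have left (k : ℕ) (hk : k < B) (hk' : i.val + k < n) :
      blockString a b n h f ⟨i.val + k, hk'⟩ = a := by
    refine if_neg ?_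
    rintro ⟨s', hs'⟩
    simp only at hs'
    omega
  refine lce_eq_of_isGreatest ⟨⟨by omega, by omega, fun k hk => ?_⟩, ?_⟩
  · rw [left k (by omega)]
    refine (if_neg ?_).symm
    rintro ⟨s', hs'⟩
    simp only at hs'
    have hfs' := (f s').isLt
    have heq : (s : ℕ) * B + k = s' * B + f s' := by omega
    have hss : s = s' := by
      have h1 : ((s : ℕ) * B + k) / B = s := by
        rw [mul_comm, Nat.mul_add_div (by omega), Nat.div_eq_of_lt (by omega), add_zero]
      have h2 : ((s' : ℕ) * B + f s') / B = s' := by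
        rw [mul_comm, Nat.mul_add_div (by omega), Nat.div_eq_of_lt (by omega), add_zero]
      exact Fin.ext (by rw [← h1, ← h2, heq])
    subst hss
    omega
  · rintro l ⟨_, hl, hagree⟩
    by_contra hlt
    have := hagree (f s) (not_le.1 hlt)
    rw [left _ hfs] at this
    refine hab (this.trans (if_pos ⟨s, ?_⟩))
    simp only
    omega

/-! ### The trade-off between space and time -/

namespace LCEDataStructure

theorem card_memory {α : Type*} {n : ℕ} (D : LCEDataStructure α n) :
    Fintype.card ((k : Fin D.cells) → Fin (D.width k) → Bool) = 2 ^ D.space := by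
  simp [space, Finset.prod_pow_eq_pow_sum]

/-- A data structure has to probe at least one cell for some query. -/
theorem one_le_of_time_le {α : Type*} [Nontrivial α] {n : ℕ} (hn : 2 ≤ n)
    (D : LCEDataStructure α n) {t : ℕ} (ht : ∀ T i j, D.time T i j ≤ t) : 1 ≤ t := by
  obtain ⟨a, b, hab⟩ := exists_pair_ne α
  by_contra hlt
  let i : Fin n := ⟨0, by omega⟩
  let j : Fin n := ⟨1, by omega⟩
  -- An algorithm without probes answers independently of the string.
  have hconst (T T' : Fin n → α) : lce T i j = lce T' i j := by
    have h0 := ht T i j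
    rw [← D.correct T i j, ← D.correct T' i j]
    unfold time at h0
    cases hq : D.query i j with
    | answer c => rfl
    | probeInput p next => rw [hq, Algorithm.probes] at h0; omega
    | probeExtra k next => rw [hq, Algorithm.probes] at h0; omega
  have h1 : lce (fun _ => a) i j ≥ 1 :=
    (isGreatest_lce (fun _ => a) i j).2 ⟨by simp only [i]; omega, by simp only [j]; omega,
      fun _ _ => rfl⟩
  have h2 : lce (fun p : Fin n => if p.val = 0 then a else b) i j = 0 := by
    refine lce_eq_of_isGreatest ⟨⟨by omega, by omega, fun k hk => by omega⟩, ?_⟩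
    rintro l ⟨_, _, hagree⟩
    by_contra hl
    have := hagree 0 (by omega)
    simp [i, j, hab] at this
  rw [hconst _ fun p : Fin n => if p.val = 0 then a else b, h2] at h1
  omega

/-- The counting bound: with `S` bits of additional space and query time `t`, the `B ^ N` block
strings with `N` blocks of length `B` satisfy `B ^ N ≤ 2 ^ S * (e * t) ^ N`. -/
theorem pow_le_two_pow_space_mul {α : Type*} [Nontrivial α] {n : ℕ}
    (D : LCEDataStructure α n) {t h N B : ℕ} (ht1 : 1 ≤ t) (ht : ∀ T i j, D.time T i j ≤ t)
    (hB0 : 0 < B) (hB : B ≤ h) (hn : h + N * B ≤ n) :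
    (B : ℝ) ^ N ≤ 2 ^ D.space * (Real.exp 1 * t) ^ N := by
  classical
  obtain ⟨a, b, hab⟩ := exists_pair_ne α
  let i : Fin n := ⟨0, by omega⟩
  let j (s : Fin N) : Fin n := ⟨h + s * B, by
    have : (s + 1 : ℕ) * B ≤ N * B := Nat.mul_le_mul_right _ s.isLt
    rw [add_mul, one_mul] at this
    omega⟩
  have hlce (f : Fin N → Fin B) (s : Fin N) : lce (blockString a b n h f) i (j s) = f s :=
    lce_blockString hab hB hn f s rfl rfl
  let F : Finset (Fin n → α) := Finset.univ.image (blockString (N := N) (B := B) a b n h)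
  have hcard : #F = B ^ N := by
    rw [Finset.card_image_of_injective _ fun f g hfg => funext fun s => Fin.ext ?_]
    · simp
    · rw [← hlce f s, ← hlce g s, hfg]
  have hfiber (M : (k : Fin D.cells) → Fin (D.width k) → Bool) :
      (#{T ∈ F | D.preprocess T = M} : ℝ) ≤ (Real.exp 1 * t) ^ N := by
    refine Algorithm.card_le (a := a) (b := b) M
      (Algorithm.sequence (List.ofFn fun s => D.query i (j s))) ht1 _ ?_ ?_ ?_ ?_
    · intro T hT p
      obtain ⟨f, -, rfl⟩ := Finset.mem_image.1 (Finset.mem_filter.1 hT).1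
      exact blockString_eq_or a b n h f p
    · intro T hT
      obtain ⟨f, -, rfl⟩ := Finset.mem_image.1 (Finset.mem_filter.1 hT).1
      exact card_blockString_le hab n h f
    · intro T hT
      obtain ⟨-, rfl⟩ := Finset.mem_filter.1 hT
      rw [Algorithm.probes_sequence, List.map_ofFn, List.sum_ofFn]
      calc _ ≤ ∑ _s : Fin N, t := Finset.sum_le_sum fun s _ => ht T i (j s)
        _ = t * N := by simp [mul_comm]
    · intro T hT T' hT' heq
      obtain ⟨hTF, hM⟩ := Finset.mem_filter.1 hT
      obtain ⟨hTF', hM'⟩ := Finset.mem_filter.1 hT'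
      obtain ⟨f, -, rfl⟩ := Finset.mem_image.1 hTF
      obtain ⟨g, -, rfl⟩ := Finset.mem_image.1 hTF'
      simp only [Algorithm.output_sequence, List.map_ofFn] at heq
      have hfg : f = g := funext fun s => Fin.ext <| by
        have := congrFun (List.ofFn_injective heq) s
        simp only [Function.comp_apply] at this
        rw [← hlce f s, ← hlce g s, ← D.correct, ← D.correct, hM, hM', this]
      rw [hfg]
  have hsum := Finset.card_eq_sum_card_fiberwise (f := D.preprocess) (s := F)
    (t := Finset.univ) (fun _ _ => Finset.mem_coe.2 (Finset.mem_univ _))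
  calc (B : ℝ) ^ N = ∑ M, (#{T ∈ F | D.preprocess T = M} : ℝ) := by
        rw [← Nat.cast_pow, ← hcard, hsum, Nat.cast_sum]
    _ ≤ ∑ _M : (k : Fin D.cells) → Fin (D.width k) → Bool, (Real.exp 1 * t) ^ N :=
        Finset.sum_le_sum fun M _ => hfiber M
    _ = 2 ^ D.space * (Real.exp 1 * t) ^ N := by
        rw [Finset.sum_const, Finset.card_univ, D.card_memory, nsmul_eq_mul]
        push_cast
        rfl

/-- The trade-off with an explicit constant, for a natural number bounding the query time. -/
theorem le_mul_of_time_le {α : Type*} [Nontrivial α] {n : ℕ} {C τ : ℝ} (hC : 0 < C)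
    (hn : 2 ≤ n) (hτ1 : 1 ≤ τ) (hτn : τ ≤ n) (D : LCEDataStructure α n)
    (hS : (D.space : ℝ) ≤ C * (n / τ)) {t : ℕ} (ht : ∀ T i j, D.time T i j ≤ t) :
    τ ≤ 4 * (2 : ℝ) ^ (6 * C) * Real.exp 1 * t := by
  have ht1 : 1 ≤ t := D.one_le_of_time_le hn ht
  set h := n / 2 with hh
  -- Halving `τ` keeps `B ≤ n / 2`; the maximum with 1 covers `τ < 2`.
  set B := max 1 ⌊τ / 2⌋₊ with hBdef
  have hB0 : 0 < B := by omega
  have hfloor : ⌊τ / 2⌋₊ ≤ h := by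
    rw [hh, ← Nat.floor_div_eq_div (K := ℝ)]
    exact Nat.floor_le_floor (by push_cast; linarith)
  have hBh : B ≤ h := by omega
  have hBτ : (B : ℝ) ≤ τ := by
    rw [hBdef, Nat.cast_max]
    exact max_le (by simpa using hτ1) ((Nat.floor_le (by linarith)).trans (by linarith))
  have hτB : τ ≤ 4 * B := by
    have h1 : (1 : ℝ) ≤ B := by exact_mod_cast hB0
    have h2 : (⌊τ / 2⌋₊ : ℝ) ≤ B := by exact_mod_cast le_max_right _ _
    have h3 := Nat.lt_floor_add_one (τ / 2)
    linarith
  set N := h / B with hN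
  have hN1 : 1 ≤ N := (Nat.one_le_div_iff hB0).2 hBh
  have hNB : N * B ≤ h := Nat.div_mul_le_self h B
  have hcount := D.pow_le_two_pow_space_mul (N := N) ht1 ht hB0 hBh (by omega)
  -- From `h < (N + 1) * B ≤ 2 * N * B` and `n ≤ 2 * h + 1`; the constant is not optimized.
  have hnNB : n ≤ 6 * N * B := by
    have h1 : h < (N + 1) * B := by
      rw [mul_comm]; exact Nat.lt_mul_div_succ h hB0
    have h2 : B ≤ N * B := Nat.le_mul_of_pos_left B hN1
    rw [add_mul, one_mul] at h1
    rw [mul_assoc]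
    omega
  have hspace : (D.space : ℝ) ≤ 6 * C * N := by
    have h1 : (n : ℝ) / τ ≤ 6 * N := by
      rw [div_le_iff₀ (by linarith)]
      calc (n : ℝ) ≤ 6 * N * B := by exact_mod_cast hnNB
        _ ≤ 6 * N * τ := by gcongr
    calc (D.space : ℝ) ≤ C * (n / τ) := hS
      _ ≤ C * (6 * N) := by gcongr
      _ = 6 * C * N := by ring
  have hpow : (2 : ℝ) ^ D.space ≤ ((2 : ℝ) ^ (6 * C)) ^ N := by
    rw [← Real.rpow_natCast, ← Real.rpow_natCast, ← Real.rpow_mul (by norm_num)]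
    exact Real.rpow_le_rpow_of_exponent_le (by norm_num) hspace
  have hle : (B : ℝ) ^ N ≤ ((2 : ℝ) ^ (6 * C) * (Real.exp 1 * t)) ^ N := by
    rw [mul_pow]
    exact hcount.trans (by gcongr)
  have := le_of_pow_le_pow_left₀ (by omega) (by positivity) hle
  linarith

theorem time_le_queryTime {α : Type*} {n : ℕ} (D : LCEDataStructure α n) (T : Fin n → α)
    (i j : Fin n) : (D.time T i j : ℕ∞) ≤ D.queryTime :=
  le_iSup_of_le T (le_iSup_of_le i (le_iSup_of_le j le_rfl))

end LCEDataStructure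

end CellProbe

theorem mainTheorem2 :
    ∀ C : ℝ, 0 < C → ∃ c : ℝ, 0 < c ∧
      ∀ (α : Type*) [Nontrivial α] (n : ℕ) (τ : ℝ), 2 ≤ n → 1 ≤ τ → τ ≤ n →
        ∀ D : CellProbe.LCEDataStructure α n, (D.space : ℝ) ≤ C * (n / τ) →
          ENNReal.ofReal (c * τ) ≤ (D.queryTime : ENNReal) := by
  intro C hC
  refine ⟨(4 * (2 : ℝ) ^ (6 * C) * Real.exp 1)⁻¹, by positivity, ?_⟩
  intro α _ n τ hn hτ1 hτn D hS
  cases hq : D.queryTime with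
  | top => simp
  | coe t =>
    have ht : ∀ T i j, D.time T i j ≤ t := fun T i j => by
      have := D.time_le_queryTime T i j
      rw [hq] at this
      exact_mod_cast this
    have key := D.le_mul_of_time_le hC hn hτ1 hτn hS ht
    have hle : (4 * (2 : ℝ) ^ (6 * C) * Real.exp 1)⁻¹ * τ ≤ t := by
      rw [inv_mul_le_iff₀ (by positivity)]
      exact key
    calc ENNReal.ofReal _ ≤ ENNReal.ofReal (t : ℝ) := ENNReal.ofReal_le_ofReal hle
      _ = ((t : ℕ∞) : ENNReal) := by simp
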